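/- Let $G$ be a finite connected simple graph with vertex set $[d]$ and edge set $E(G)$. For an edge $e=\{i,j\}$ put $\rho(e)=\mathbf e_i+\mathbf e_j\in\mathbb R^d$, and let $\mathcal P_G=\operatorname{conv}\{\rho(e): e\in E(G)\}$ be the edge polytope of $G$. Let $\mathcal H=\{x\in\mathbb R^d:\sum_i a_ix_i=b\}$, with $0\neq a\in\mathbb R^d$ and $b\in\mathbb R$, be a separating hyperplane of $\mathcal P_G$: that is, $\mathcal H$ meets the relative interior of $\mathcal P_G$, and both polytopes $\mathcal P_G\cap\mathcal H^{(+)}$ and $\mathcal P_G\cap\mathcal H^{(-)}$ are integral (all their vertices have integer coordinates), where $\mathcal H^{(+)}=\{\sum_i a_ix_i\ge b\}$ and $\mathcal H^{(-)}=\{\sum_i a_ix_i\le b\}$. Let $G_+$ and $G_-$ be the spanning subgraphs of $G$ whose edges are the edges $e$ of $G$ with $\rho(e)\in\mathcal H^{(+)}$ and $\rho(e)\in\mathcal H^{(-)}$, respectively (so that $\mathcal P_{G_\pm}=\mathcal P_G\cap\mathcal H^{(\pm)}$ and $\mathcal P_G=\mathcal P_{G_+}\cup\mathcal P_{G_-}$).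 Let $K$ be a field. For a simple graph $\Gamma$ on $[d]$, the toric ideal $I_\Gamma$ is the kernel of the $K$-algebra homomorphism $K[x_e: e\in E(\Gamma)]\to K[t_1,\dots,t_d]$ that sends $x_e$ to $t_it_j$ for $e=\{i,j\}$. A quadratic binomial is a difference of two distinct monomials of degree $2$; the zero ideal counts as generated by the empty set of binomials. If $I_{G_+}$ and $I_{G_-}$ are both generated by quadratic binomials, then $I_G$ is generated by quadratic binomials. -/

import Mathlib

namespace EdgePolytope

open MvPolynomial

/-- The vector `ρ(e) = 𝐞ᵢ + 𝐞ⱼ` of `ℝ^V` attached to the pair `e = {i, j}`. -/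
def edgeVector {V : Type*} [DecidableEq V] (e : Sym2 V) : V → ℝ :=
  Sym2.lift ⟨fun i j => Pi.single i 1 + Pi.single j 1, fun _ _ => add_comm _ _⟩ e

/-- The edge polytope of `G`: the convex hull of the vectors `ρ(e)`, `e` an edge of `G`. -/
def edgePolytope {V : Type*} [DecidableEq V] (G : SimpleGraph V) : Set (V → ℝ) :=
  convexHull ℝ (edgeVector '' G.edgeSet)

/-- The set of points with `∑ aᵢ xᵢ = b`; a hyperplane when `a ≠ 0`. -/
def hyperplane {V : Type*} [Fintype V] (a : V → ℝ) (b : ℝ) : Set (V → ℝ) :=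
  {x | ∑ i, a i * x i = b}

/-- The closed half-space `∑ aᵢ xᵢ ≥ b`. -/
def posHalfSpace {V : Type*} [Fintype V] (a : V → ℝ) (b : ℝ) : Set (V → ℝ) :=
  {x | b ≤ ∑ i, a i * x i}

/-- The closed half-space `∑ aᵢ xᵢ ≤ b`. -/
def negHalfSpace {V : Type*} [Fintype V] (a : V → ℝ) (b : ℝ) : Set (V → ℝ) :=
  {x | ∑ i, a i * x i ≤ b}

/-- A polytope is integral if all its vertices (extreme points) have integer coordinates. -/
def IsIntegralPolytope {V : Type*} (P : Set (V → ℝ)) : Prop :=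
  ∀ x ∈ P.extremePoints ℝ, ∀ i, ∃ n : ℤ, x i = n

/-- `∑ aᵢ xᵢ = b` defines a separating hyperplane of the polytope `P`: it is a hyperplane that
meets the (relative) interior of `P` and cuts `P` into two integral polytopes. -/
structure IsSeparatingHyperplane {V : Type*} [Fintype V] (P : Set (V → ℝ))
    (a : V → ℝ) (b : ℝ) : Prop where
  ne_zero : a ≠ 0
  meets_interior : (hyperplane a b ∩ intrinsicInterior ℝ P).Nonempty
  integral_pos : IsIntegralPolytope (P ∩ posHalfSpace a b)
  integral_neg : IsIntegralPolytope (P ∩ negHalfSpace a b)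

/-- The spanning subgraph `G₊` of the edges `e` of `G` with `ρ(e)` in the half-space
`∑ aᵢ xᵢ ≥ b`. -/
def posSubgraph {V : Type*} [Fintype V] [DecidableEq V] (G : SimpleGraph V)
    (a : V → ℝ) (b : ℝ) : SimpleGraph V where
  Adj i j := G.Adj i j ∧ edgeVector s(i, j) ∈ posHalfSpace a b
  symm := ⟨fun i j h => ⟨h.1.symm, Sym2.eq_swap (a := i) (b := j) ▸ h.2⟩⟩
  loopless := ⟨fun i h => G.loopless.irrefl i h.1⟩

/-- The spanning subgraph `G₋` of the edges `e` of `G` with `ρ(e)` in the half-space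
`∑ aᵢ xᵢ ≤ b`. -/
def negSubgraph {V : Type*} [Fintype V] [DecidableEq V] (G : SimpleGraph V)
    (a : V → ℝ) (b : ℝ) : SimpleGraph V where
  Adj i j := G.Adj i j ∧ edgeVector s(i, j) ∈ negHalfSpace a b
  symm := ⟨fun i j h => ⟨h.1.symm, Sym2.eq_swap (a := i) (b := j) ▸ h.2⟩⟩
  loopless := ⟨fun i h => G.loopless.irrefl i h.1⟩

/-- The monomial `𝐭^e = tᵢ tⱼ` attached to the pair `e = {i, j}`. -/
noncomputable def edgeMonomial (K : Type*) [Field K] {V : Type*} (e : Sym2 V) :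
    MvPolynomial V K :=
  Sym2.lift ⟨fun i j => X i * X j, fun _ _ => mul_comm _ _⟩ e

/-- The `K`-algebra homomorphism `K[x_e : e ∈ E(G)] → K[t_v : v ∈ V]`, `x_e ↦ 𝐭^e`, whose image
is the edge ring `K[G]`. -/
noncomputable def edgeRingHom (K : Type*) [Field K] {V : Type*} (G : SimpleGraph V) :
    MvPolynomial G.edgeSet K →ₐ[K] MvPolynomial V K :=
  aeval fun e => edgeMonomial K (e : Sym2 V)

/-- The toric ideal `I_G`. -/
noncomputable def toricIdeal (K : Type*) [Field K] {V : Type*} (G : SimpleGraph V) :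
    Ideal (MvPolynomial G.edgeSet K) :=
  RingHom.ker (edgeRingHom K G)

/-- A quadratic binomial: a difference of two distinct monomials of degree two. -/
def IsQuadraticBinomial {K : Type*} [Field K] {σ : Type*} (f : MvPolynomial σ K) : Prop :=
  ∃ u v : σ →₀ ℕ, u ≠ v ∧ u.degree = 2 ∧ v.degree = 2 ∧ f = monomial u 1 - monomial v 1

/-- `G` is quadratic over `K`: its toric ideal is generated by quadratic binomials
(the zero ideal is generated by the empty set). -/
def IsQuadratic (K : Type*) [Field K] {V : Type*} (G : SimpleGraph V) : Prop :=
  ∃ S : Set (MvPolynomial G.edgeSet K),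
    (∀ f ∈ S, IsQuadraticBinomial f) ∧ toricIdeal K G = Ideal.span S

end EdgePolytope

/-!
If `ρ(e)` and `ρ(f)` lie strictly on opposite sides of `ℋ`, then the segment joining them is not an
edge of `𝒫_G`: otherwise its intersection with `ℋ` would be a vertex of `𝒫_G ∩ ℋ⁺` with a
coordinate strictly between `0` and `1`. Since two edges with a common vertex, and two disjoint
edges that are not opposite in a `4`-cycle, always span an edge of `𝒫_G`, the edges `e` and `f` are
opposite in a `4`-cycle, and its other two edges `g` and `h` do not lie strictly on the positive
side. Replacing `x_e x_f` by `x_g x_h` modulo the quadratic binomial `x_e x_f - x_g x_h`, one brings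
every monomial to a form where its edges all belong to `G₊` or all belong to `G₋`.

Let two monomials of this form have the same image in `K[t]`. The functional defining `ℋ` takes the
same value on their exponents, so if one is supported on `G₊` and the other on `G₋`, then both are
supported on `ℋ`. In all cases their difference is a binomial of `I_{G₊}` or of `I_{G₋}`.
-/

namespace EdgePolytope

section Faces

open Set

variable {𝕜 E : Type*} [Ring 𝕜] [LinearOrder 𝕜] [IsStrictOrderedRing 𝕜] [AddCommGroup E]
  [Module 𝕜 E]

theorem isExtreme_setOf_eq_of_le {A : Set E} (φ : E →ₗ[𝕜] 𝕜) {M : 𝕜} (hle : ∀ x ∈ A, φ x ≤ M) :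
    IsExtreme 𝕜 A {x ∈ A | φ x = M} := by
  refine ⟨fun x hx => hx.1, ?_⟩
  rintro x hx y hy _ ⟨-, hM⟩ ⟨s, t, hs, ht, hst, rfl⟩
  refine ⟨hx, (hle x hx).eq_of_not_lt fun hlt => hM.not_lt ?_⟩
  calc φ (s • x + t • y) = s * φ x + t * φ y := by simp
    _ < s * M + t * M := add_lt_add_of_lt_of_le (mul_lt_mul_of_pos_left hlt hs)
        (mul_le_mul_of_nonneg_left (hle y hy) ht.le)
    _ = M := by rw [← add_mul, hst, one_mul]

theorem subset_convexHull_inter_of_isExtreme {S F : Set E}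
    (hF : IsExtreme 𝕜 (convexHull 𝕜 S) F) : F ⊆ convexHull 𝕜 (S ∩ F) := by
  let C : Set E := {x ∈ convexHull 𝕜 S | x ∈ F → x ∈ convexHull 𝕜 (S ∩ F)}
  have hC : Convex 𝕜 C := by
    rw [convex_iff_openSegment_subset]
    refine fun x hx y hy z hz => ⟨(convex_convexHull 𝕜 S).openSegment_subset hx.1 hy.1 hz, ?_⟩
    exact fun hzF => (convex_convexHull 𝕜 (S ∩ F)).openSegment_subset
      (hx.2 (hF.left_mem_of_mem_openSegment hx.1 hy.1 hzF hz))
      (hy.2 (hF.right_mem_of_mem_openSegment hx.1 hy.1 hzF hz)) hz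
  have hSC : S ⊆ C := fun x hx =>
    ⟨subset_convexHull 𝕜 S hx, fun hxF => subset_convexHull 𝕜 _ ⟨hx, hxF⟩⟩
  exact fun x hx => (convexHull_min hSC hC (hF.subset hx)).2 hx

theorem isExtreme_convexHull_setOf_eq_of_le {S : Set E} (φ : E →ₗ[𝕜] 𝕜) {M : 𝕜}
    (hle : ∀ x ∈ S, φ x ≤ M) :
    IsExtreme 𝕜 (convexHull 𝕜 S) (convexHull 𝕜 {x ∈ S | φ x = M}) := by
  have hle' : ∀ x ∈ convexHull 𝕜 S, φ x ≤ M :=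
    convexHull_min hle (convex_halfSpace_le φ.isLinear M)
  have hface := isExtreme_setOf_eq_of_le φ hle'
  have heq : convexHull 𝕜 {x ∈ S | φ x = M} = {x ∈ convexHull 𝕜 S | φ x = M} := by
    refine Subset.antisymm (convexHull_min ?_ ?_) ?_
    · exact fun x hx => ⟨subset_convexHull 𝕜 S hx.1, hx.2⟩
    · exact (convex_convexHull 𝕜 S).inter (convex_hyperplane φ.isLinear M)
    · exact (subset_convexHull_inter_of_isExtreme hface).trans
        (convexHull_mono fun x hx => ⟨hx.1, hx.2.2⟩)
  rwa [heq]

theorem injOn_segment (φ : E →ₗ[𝕜] 𝕜) {p q : E} (hpq : φ p ≠ φ q) : InjOn φ (segment 𝕜 p q) := by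
  rw [segment_eq_image_lineMap]
  rintro _ ⟨s, -, rfl⟩ _ ⟨t, -, rfl⟩ hst
  have hst' : AffineMap.lineMap (φ p) (φ q) s = AffineMap.lineMap (φ p) (φ q) t :=
    (φ.toAffineMap.apply_lineMap p q s).symm.trans (hst.trans (φ.toAffineMap.apply_lineMap p q t))
  rw [AffineMap.lineMap_injective 𝕜 hpq hst']

theorem mem_extremePoints_inter_halfSpace {P : Set E} {p q x : E}
    (hedge : IsExtreme 𝕜 P (segment 𝕜 p q)) (φ : E →ₗ[𝕜] 𝕜) (hpq : φ p ≠ φ q)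
    (hx : x ∈ segment 𝕜 p q) : x ∈ (P ∩ {y | φ x ≤ φ y}).extremePoints 𝕜 := by
  set A := P ∩ {y | φ x ≤ φ y} with hA
  have hmin : IsExtreme 𝕜 A {y ∈ A | (-φ) y = -φ x} :=
    isExtreme_setOf_eq_of_le (-φ) fun y hy => neg_le_neg hy.2
  have hseg : IsExtreme 𝕜 A (segment 𝕜 p q ∩ {y | φ x ≤ φ y}) :=
    ⟨inter_subset_inter_left _ hedge.subset, fun y hy z hz w hw hwyz =>
      ⟨hedge.left_mem_of_mem_openSegment hy.1 hz.1 hw.1 hwyz, hy.2⟩⟩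
  have hsingle : segment 𝕜 p q ∩ {y | φ x ≤ φ y} ∩ {y ∈ A | (-φ) y = -φ x} = {x} := by
    refine Subset.antisymm ?_ ?_
    · rintro y ⟨⟨hy, -⟩, -, hyx⟩
      exact injOn_segment φ hpq hy hx (neg_injective hyx)
    · rintro _ rfl
      exact ⟨⟨hx, le_rfl⟩, ⟨hedge.subset hx, le_rfl⟩, rfl⟩
  rw [← isExtreme_singleton, ← hsingle]
  exact hseg.inter hmin

end Faces

section EdgeSum

variable {V M : Type*}

/-- The value `c i + c j` on the pair `e = {i, j}` of a weight function `c` on the vertices. -/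
def edgeSum [AddCommMagma M] (c : V → M) (e : Sym2 V) : M :=
  (e.map c).add

@[simp]
theorem edgeSum_mk [AddCommMagma M] (c : V → M) (i j : V) : edgeSum c s(i, j) = c i + c j :=
  rfl

/-- The exponent vector of the monomial `𝐭^e`. -/
noncomputable def edgeExponent (e : Sym2 V) : V →₀ ℕ :=
  edgeSum (fun v => Finsupp.single v 1) e

theorem weight_edgeExponent [AddCommMonoid M] (c : V → M) (e : Sym2 V) :
    Finsupp.weight c (edgeExponent e) = edgeSum c e := by
  induction e with
  | h i j => simp [edgeExponent, Finsupp.weight_single]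

theorem edgeMonomial_eq_monomial (K : Type*) [Field K] (e : Sym2 V) :
    edgeMonomial K e = MvPolynomial.monomial (edgeExponent e) 1 := by
  induction e with
  | h i j => simp [edgeMonomial, edgeExponent, MvPolynomial.X, MvPolynomial.monomial_mul]

variable [DecidableEq V]

theorem edgeVector_mk_apply (i j v : V) :
    edgeVector s(i, j) v = (if v = i then 1 else 0) + (if v = j then 1 else 0) := by
  simp [edgeVector, Pi.single_apply]

theorem edgeVector_apply_eq_zero_or_one {e : Sym2 V} (he : ¬ e.IsDiag) (v : V) :
    edgeVector e v = 0 ∨ edgeVector e v = 1 := by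
  induction e with
  | h i j =>
    rw [Sym2.mk_isDiag_iff] at he
    grind [edgeVector_mk_apply]

variable [Fintype V]

theorem dotProductBilin_edgeVector (a : V → ℝ) (e : Sym2 V) :
    dotProductBilin ℝ ℝ a (edgeVector e) = edgeSum a e := by
  induction e with
  | h i j => simp [edgeVector]

theorem mem_edgeSet_posSubgraph {G : SimpleGraph V} {a : V → ℝ} {b : ℝ} {e : Sym2 V} :
    e ∈ (posSubgraph G a b).edgeSet ↔ e ∈ G.edgeSet ∧ b ≤ edgeSum a e := by
  rw [← dotProductBilin_edgeVector]
  induction e with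
  | h i j => rfl

theorem mem_edgeSet_negSubgraph {G : SimpleGraph V} {a : V → ℝ} {b : ℝ} {e : Sym2 V} :
    e ∈ (negSubgraph G a b).edgeSet ↔ e ∈ G.edgeSet ∧ edgeSum a e ≤ b := by
  rw [← dotProductBilin_edgeVector]
  induction e with
  | h i j => rfl

end EdgeSum

section Polytope

variable {V : Type*} [DecidableEq V] {G : SimpleGraph V}

theorem isExtreme_segment_edgeVector (φ : (V → ℝ) →ₗ[ℝ] ℝ) {e f : Sym2 V} (he : e ∈ G.edgeSet)
    (hf : f ∈ G.edgeSet) (hef : φ (edgeVector f) = φ (edgeVector e))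
    (hlt : ∀ g ∈ G.edgeSet, g ≠ e → g ≠ f → φ (edgeVector g) < φ (edgeVector e)) :
    IsExtreme ℝ (edgePolytope G) (segment ℝ (edgeVector e) (edgeVector f)) := by
  have hle : ∀ x ∈ edgeVector '' G.edgeSet, φ x ≤ φ (edgeVector e) := by
    rintro _ ⟨g, hg, rfl⟩
    by_cases hge : g = e
    · rw [hge]
    by_cases hgf : g = f
    · rw [hgf, hef]
    exact (hlt g hg hge hgf).le
  have hmax : {x ∈ edgeVector '' G.edgeSet | φ x = φ (edgeVector e)} =
      {edgeVector e, edgeVector f} := by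
    refine Set.Subset.antisymm ?_ (Set.pair_subset ⟨⟨e, he, rfl⟩, rfl⟩ ⟨⟨f, hf, rfl⟩, hef⟩)
    rintro _ ⟨⟨g, hg, rfl⟩, hmax⟩
    by_contra hne
    simp only [Set.mem_insert_iff, Set.mem_singleton_iff, not_or] at hne
    exact (hlt g hg (ne_of_apply_ne _ hne.1) (ne_of_apply_ne _ hne.2)).ne hmax
  rw [← convexHull_pair, ← hmax]
  exact isExtreme_convexHull_setOf_eq_of_le _ hle

theorem isExtreme_segment_of_common_vertex {i j k : V} (hij : G.Adj i j) (hik : G.Adj i k) :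
    IsExtreme ℝ (edgePolytope G) (segment ℝ (edgeVector s(i, j)) (edgeVector s(i, k))) := by
  let φ : (V → ℝ) →ₗ[ℝ] ℝ := 2 • .proj i + .proj j + .proj k
  have hφ : ∀ g, φ (edgeVector g) = 2 * edgeVector g i + edgeVector g j + edgeVector g k := by
    simp [φ]
  have hji := hij.ne'
  have hki := hik.ne'
  refine isExtreme_segment_edgeVector φ hij hik ?_ fun g hg hgij hgik => ?_
  · grind [edgeVector_mk_apply]
  induction g with
  | h m n =>
    have hmn : m ≠ n := G.ne_of_adj hg
    simp only [ne_eq, Sym2.eq_iff] at hgij hgik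
    grind [edgeVector_mk_apply]

theorem isExtreme_segment_of_not_adj {i j k l : V} (hij : G.Adj i j) (hkl : G.Adj k l)
    (hik : ¬ G.Adj i k) (hil : ¬ G.Adj i l) :
    IsExtreme ℝ (edgePolytope G) (segment ℝ (edgeVector s(i, j)) (edgeVector s(k, l))) := by
  -- `φ` is `4` on `ij` and `kl`, `5` on the non-edges `ik` and `il`, and at most `3` otherwise.
  let φ : (V → ℝ) →ₗ[ℝ] ℝ := 3 • .proj i + .proj j + 2 • .proj k + 2 • .proj l
  have hφ : ∀ g, φ (edgeVector g) =
      3 * edgeVector g i + edgeVector g j + 2 * edgeVector g k + 2 * edgeVector g l := by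
    simp [φ]
  have hji := hij.ne'
  have hlk := hkl.ne'
  have hki : k ≠ i := by rintro rfl; exact hil hkl
  have hli : l ≠ i := by rintro rfl; exact hik hkl.symm
  have hkj : k ≠ j := by rintro rfl; exact hik hij
  have hlj : l ≠ j := by rintro rfl; exact hil hij
  refine isExtreme_segment_edgeVector φ hij hkl ?_ fun g hg hgij hgkl => ?_
  · grind [edgeVector_mk_apply]
  induction g with
  | h m n =>
    have hmn : G.Adj m n := hg
    have hmn' := hmn.symm
    have hne := hmn.ne
    simp only [ne_eq, Sym2.eq_iff] at hgij hgkl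
    grind [edgeVector_mk_apply]

variable [Fintype V] {a : V → ℝ} {b : ℝ}

theorem not_isExtreme_segment_of_separated
    (hint : IsIntegralPolytope (edgePolytope G ∩ posHalfSpace a b)) {e f : Sym2 V}
    (he : e ∈ G.edgeSet) (hf : f ∈ G.edgeSet) (hpos : b < edgeSum a e) (hneg : edgeSum a f < b) :
    ¬ IsExtreme ℝ (edgePolytope G) (segment ℝ (edgeVector e) (edgeVector f)) := by
  intro hedge
  rw [← dotProductBilin_edgeVector] at hpos hneg
  set φ := dotProductBilin ℝ ℝ a
  obtain ⟨x, hx, rfl⟩ : b ∈ φ '' openSegment ℝ (edgeVector e) (edgeVector f) := by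
    rw [← LinearMap.coe_toAffineMap, image_openSegment, openSegment_symm,
      LinearMap.coe_toAffineMap, openSegment_eq_Ioo (hneg.trans hpos)]
    exact ⟨hneg, hpos⟩
  have hvertex := mem_extremePoints_inter_halfSpace hedge φ (hneg.trans hpos).ne'
    (openSegment_subset_segment ℝ _ _ hx)
  obtain ⟨v, hv⟩ : ∃ v, edgeVector e v ≠ edgeVector f v :=
    Function.ne_iff.1 (ne_of_apply_ne φ (hneg.trans hpos).ne')
  obtain ⟨n, hn⟩ := hint x hvertex v
  obtain ⟨h0, h1⟩ : 0 < (n : ℝ) ∧ (n : ℝ) < 1 := by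
    obtain ⟨s, t, hs, ht, hst, rfl⟩ := hx
    rw [← hn]
    rcases edgeVector_apply_eq_zero_or_one (G.not_isDiag_of_mem_edgeSet he) v with hev | hev <;>
    rcases edgeVector_apply_eq_zero_or_one (G.not_isDiag_of_mem_edgeSet hf) v with hfv | hfv <;>
    simp only [hev, hfv, ne_eq, not_true, Pi.add_apply, Pi.smul_apply, smul_eq_mul] at hv ⊢ <;>
    constructor <;> linarith
  norm_cast at h0 h1
  omega

theorem edgeSum_le_of_common_vertex
    (hint : IsIntegralPolytope (edgePolytope G ∩ posHalfSpace a b)) {i j k : V}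
    (hij : G.Adj i j) (hik : G.Adj i k) (hneg : edgeSum a s(i, k) < b) :
    edgeSum a s(i, j) ≤ b := by
  by_contra! hpos
  exact not_isExtreme_segment_of_separated hint hij hik hpos hneg
    (isExtreme_segment_of_common_vertex hij hik)

theorem exists_opposite_edges_of_separated
    (hint : IsIntegralPolytope (edgePolytope G ∩ posHalfSpace a b)) {i j k l : V}
    (hij : G.Adj i j) (hkl : G.Adj k l) (hpos : b < edgeSum a s(i, j))
    (hneg : edgeSum a s(k, l) < b) :
    G.Adj i k ∧ G.Adj j l ∨ G.Adj i l ∧ G.Adj j k := by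
  have hedge := not_isExtreme_segment_of_separated hint hij hkl hpos hneg
  have hi : G.Adj i k ∨ G.Adj i l := by
    by_contra! h
    exact hedge (isExtreme_segment_of_not_adj hij hkl h.1 h.2)
  have hj : G.Adj j k ∨ G.Adj j l := by
    by_contra! h
    exact hedge (Sym2.eq_swap (a := i) ▸ isExtreme_segment_of_not_adj hij.symm hkl h.1 h.2)
  have hk : G.Adj k i ∨ G.Adj k j := by
    by_contra! h
    rw [segment_symm] at hedge
    exact hedge (isExtreme_segment_of_not_adj hkl hij h.1 h.2)
  have hl : G.Adj l i ∨ G.Adj l j := by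
    by_contra! h
    rw [segment_symm, Sym2.eq_swap (a := k)] at hedge
    exact hedge (isExtreme_segment_of_not_adj hkl.symm hij h.1 h.2)
  rw [G.adj_comm k, G.adj_comm k] at hk
  rw [G.adj_comm l, G.adj_comm l] at hl
  tauto

theorem exists_exchange_of_separated
    (hint : IsIntegralPolytope (edgePolytope G ∩ posHalfSpace a b)) {e f : Sym2 V}
    (he : e ∈ G.edgeSet) (hf : f ∈ G.edgeSet) (hpos : b < edgeSum a e) (hneg : edgeSum a f < b) :
    ∃ g ∈ G.edgeSet, ∃ h ∈ G.edgeSet, edgeSum a g ≤ b ∧ edgeSum a h ≤ b ∧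
      edgeExponent e + edgeExponent f = edgeExponent g + edgeExponent h := by
  induction e with | h i j =>
  induction f with | h k l =>
  have hneg' : edgeSum a s(l, k) < b := by rwa [Sym2.eq_swap]
  have hk : ∀ {m}, G.Adj k m → edgeSum a s(k, m) ≤ b := fun hkm =>
    edgeSum_le_of_common_vertex hint hkm hf hneg
  have hl : ∀ {m}, G.Adj l m → edgeSum a s(l, m) ≤ b := fun hlm =>
    edgeSum_le_of_common_vertex hint hlm (G.mem_edgeSet.1 hf).symm hneg'
  rcases exists_opposite_edges_of_separated hint he hf hpos hneg with ⟨hik, hjl⟩ | ⟨hil, hjk⟩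
  · refine ⟨s(k, i), hik.symm, s(l, j), hjl.symm, hk hik.symm, hl hjl.symm, ?_⟩
    simp only [edgeExponent, edgeSum_mk]
    abel
  · refine ⟨s(l, i), hil.symm, s(k, j), hjk.symm, hl hil.symm, hk hjk.symm, ?_⟩
    simp only [edgeExponent, edgeSum_mk]
    abel

end Polytope

section Binomials

open MvPolynomial

variable {R σ τ : Type*} [CommRing R]

/-- The congruence of exponents modulo an ideal `J`: `u` and `v` are congruent if the binomial
`x^u - x^v` belongs to `J`. -/
def binomialCon (J : Ideal (MvPolynomial σ R)) : AddCon (σ →₀ ℕ) where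
  r u v := monomial u 1 - monomial v 1 ∈ J
  iseqv :=
    { refl := fun u => by simp
      symm := fun huv => by rw [← neg_sub]; exact J.neg_mem huv
      trans := fun huv hvw => by rw [← sub_add_sub_cancel]; exact J.add_mem huv hvw }
  add' := by
    intro u v u' v' huv huv'
    have hmem := J.add_mem (J.mul_mem_right (monomial u' 1) huv)
      (J.mul_mem_left (monomial v 1) huv')
    simpa only [sub_mul, mul_sub, monomial_mul, one_mul, sub_add_sub_cancel] using hmem

theorem binomialCon_iff {J : Ideal (MvPolynomial σ R)} {u v : σ →₀ ℕ} :
    binomialCon J u v ↔ monomial u 1 - monomial v 1 ∈ J :=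
  Iff.rfl

theorem binomialCon_mono {J J' : Ideal (MvPolynomial σ R)} (h : J ≤ J') :
    binomialCon J ≤ binomialCon J' :=
  fun _ _ huv => h huv

theorem ker_le_of_forall_monomial_sub_monomial_mem
    (φ : MvPolynomial σ R →ₗ[R] MvPolynomial τ R) (A : (σ →₀ ℕ) → (τ →₀ ℕ))
    (hφ : ∀ u, φ (monomial u 1) = monomial (A u) 1) (J : Submodule R (MvPolynomial σ R))
    (hJ : ∀ u v, A u = A v → monomial u 1 - monomial v 1 ∈ J) : LinearMap.ker φ ≤ J := by
  let ψ : MvPolynomial τ R →ₗ[R] MvPolynomial σ R ⧸ J :=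
    (basisMonomials τ R).constr R fun w => J.mkQ (monomial (Function.invFun A w) 1)
  have hψ : ∀ w, ψ (monomial w 1) = J.mkQ (monomial (Function.invFun A w) 1) := fun w => by
    simpa only [coe_basisMonomials] using (basisMonomials τ R).constr_basis R _ w
  have hfactor : ψ ∘ₗ φ = J.mkQ := by
    refine (basisMonomials σ R).ext fun u => ?_
    rw [coe_basisMonomials, LinearMap.comp_apply, hφ, hψ]
    exact (Submodule.Quotient.eq J).2 (hJ _ _ (Function.invFun_eq ⟨u, rfl⟩))
  calc LinearMap.ker φ ≤ LinearMap.ker (ψ ∘ₗ φ) := LinearMap.ker_le_ker_comp φ ψ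
    _ = J := by rw [hfactor, Submodule.ker_mkQ]

theorem exists_eq_single_add_single_add {u : σ →₀ ℕ} {e f : σ} (hef : e ≠ f)
    (he : e ∈ u.support) (hf : f ∈ u.support) :
    ∃ r, u = .single e 1 + .single f 1 + r := by
  rw [Finsupp.mem_support_iff, ← Nat.one_le_iff_ne_zero] at he hf
  refine le_iff_exists_add.1 fun g => ?_
  classical
  simp only [Finsupp.add_apply, Finsupp.single_apply]
  grind

theorem exists_rel_nonneg_or_nonpos {M : Type*} [Zero M] [LinearOrder M] (w : σ → M)
    (C : AddCon (σ →₀ ℕ))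
    (hC : ∀ e f, 0 < w e → w f < 0 → ∃ g h, w g ≤ 0 ∧ w h ≤ 0 ∧
      C (.single e 1 + .single f 1) (.single g 1 + .single h 1)) (u : σ →₀ ℕ) :
    ∃ v, C u v ∧ ((∀ e ∈ v.support, 0 ≤ w e) ∨ ∀ e ∈ v.support, w e ≤ 0) := by
  let N : (σ →₀ ℕ) →+ ℕ := Finsupp.weight fun e => if 0 < w e then 1 else 0
  induction hn : N u using Nat.strong_induction_on generalizing u with
  | _ n ih =>
    by_cases hu : (∀ e ∈ u.support, 0 ≤ w e) ∨ ∀ e ∈ u.support, w e ≤ 0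
    · exact ⟨u, C.refl u, hu⟩
    push Not at hu
    obtain ⟨⟨f, hf, hwf⟩, e, he, hwe⟩ := hu
    obtain ⟨g, h, hwg, hwh, hex⟩ := hC e f hwe hwf
    have hef : e ≠ f := by rintro rfl; exact lt_asymm hwe hwf
    obtain ⟨r, rfl⟩ := exists_eq_single_add_single_add hef he hf
    have hlt : N (.single g 1 + .single h 1 + r) < n := by
      rw [← hn]
      simp [N, Finsupp.weight_single, hwe, hwf.not_gt, hwg.not_gt, hwh.not_gt]
    obtain ⟨v, hv, hsign⟩ := ih _ hlt _ rfl
    exact ⟨v, C.trans (C.add hex (C.refl r)) hv, hsign⟩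

theorem nonpos_of_weight_eq {M : Type*} [AddCommMonoid M] [LinearOrder M]
    [IsOrderedCancelAddMonoid M] {w : σ → M} {p q : σ →₀ ℕ}
    (hpq : Finsupp.weight w p = Finsupp.weight w q) (hp : ∀ e ∈ p.support, 0 ≤ w e)
    (hq : ∀ e ∈ q.support, w e ≤ 0) : ∀ e ∈ p.support, w e ≤ 0 := by
  intro e he
  by_contra! hwe
  have hpos : 0 < Finsupp.weight w p :=
    Finset.sum_pos' (fun f hf => nsmul_nonneg (hp f hf) _)
      ⟨e, he, nsmul_pos hwe (Finsupp.mem_support_iff.1 he)⟩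
  have hnonpos : Finsupp.weight w q ≤ 0 :=
    Finset.sum_nonpos fun f hf => nsmul_nonpos (hq f hf) _
  exact (hpq ▸ hpos).not_ge hnonpos

theorem addConKer_le_of_exchange {M N : Type*} [AddCommMonoid M] [LinearOrder M]
    [IsOrderedCancelAddMonoid M] [AddZeroClass N] {A : (σ →₀ ℕ) →+ N} {C : AddCon (σ →₀ ℕ)}
    (hCA : C ≤ AddCon.ker A) (w : σ → M)
    (hw : ∀ u v, A u = A v → Finsupp.weight w u = Finsupp.weight w v)
    (hex : ∀ e f, 0 < w e → w f < 0 → ∃ g h, w g ≤ 0 ∧ w h ≤ 0 ∧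
      C (.single e 1 + .single f 1) (.single g 1 + .single h 1))
    (hnonneg : ∀ u v, A u = A v → (∀ e ∈ u.support, 0 ≤ w e) → (∀ e ∈ v.support, 0 ≤ w e) → C u v)
    (hnonpos : ∀ u v, A u = A v → (∀ e ∈ u.support, w e ≤ 0) → (∀ e ∈ v.support, w e ≤ 0) →
      C u v) :
    AddCon.ker A ≤ C := by
  have hmixed : ∀ u v, A u = A v → (∀ e ∈ u.support, 0 ≤ w e) → (∀ e ∈ v.support, w e ≤ 0) →
      C u v :=
    fun u v huv hu hv => hnonpos u v huv (nonpos_of_weight_eq (hw u v huv) hu hv) hv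
  intro u v huv
  obtain ⟨u', hu, hu'⟩ := exists_rel_nonneg_or_nonpos w C hex u
  obtain ⟨v', hv, hv'⟩ := exists_rel_nonneg_or_nonpos w C hex v
  have huv' : A u' = A v' := (hCA hu).symm.trans (huv.trans (hCA hv))
  suffices h : C u' v' from C.trans (C.trans hu h) (C.symm hv)
  rcases hu' with hu' | hu' <;> rcases hv' with hv' | hv'
  · exact hnonneg u' v' huv' hu' hv'
  · exact hmixed u' v' huv' hu' hv'
  · exact C.symm (hmixed v' u' huv'.symm hv' hu')
  · exact hnonpos u' v' huv' hu' hv'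

end Binomials

section ToricIdeal

open MvPolynomial

variable {V : Type*}

/-- The exponent in `K[t_v : v ∈ V]` of the image of a monomial of `K[x_e : e ∈ E(G)]`, as a
function of its exponent. It is the degree sequence of the multigraph formed by the edges of the
monomial. -/
noncomputable def degreeVector (G : SimpleGraph V) : (G.edgeSet →₀ ℕ) →+ (V →₀ ℕ) :=
  Finsupp.weight fun e : G.edgeSet => edgeExponent (e : Sym2 V)

theorem degreeVector_single_add_single {G : SimpleGraph V} (e f : G.edgeSet) :
    degreeVector G (.single e 1 + .single f 1) =
      edgeExponent (e : Sym2 V) + edgeExponent (f : Sym2 V) := by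
  simp [degreeVector, Finsupp.weight_single]

theorem weight_degreeVector {M : Type*} [AddCommMonoid M] {G : SimpleGraph V} (c : V → M)
    (u : G.edgeSet →₀ ℕ) :
    Finsupp.weight c (degreeVector G u) =
      Finsupp.weight (fun e : G.edgeSet => edgeSum c (e : Sym2 V)) u := by
  suffices h : (Finsupp.weight c).comp (degreeVector G) =
      Finsupp.weight (fun e : G.edgeSet => edgeSum c (e : Sym2 V)) from DFunLike.congr_fun h u
  ext e
  simp [degreeVector, Finsupp.weight_single, weight_edgeExponent]

theorem degreeVector_mapDomain_inclusion {H G : SimpleGraph V} (h : H.edgeSet ⊆ G.edgeSet)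
    (u : H.edgeSet →₀ ℕ) :
    degreeVector G (u.mapDomain (Set.inclusion h)) = degreeVector H u := by
  suffices hcomp : (degreeVector G).comp (Finsupp.mapDomain.addMonoidHom (Set.inclusion h)) =
      degreeVector H from DFunLike.congr_fun hcomp u
  ext e
  simp [degreeVector, Finsupp.weight_single, Finsupp.mapDomain_single]

variable (K : Type*) [Field K]

theorem edgeRingHom_monomial (G : SimpleGraph V) (u : G.edgeSet →₀ ℕ) :
    edgeRingHom K G (monomial u 1) = monomial (degreeVector G u) 1 := by
  simp only [edgeRingHom, aeval_monomial, map_one, one_mul, edgeMonomial_eq_monomial,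
    degreeVector, Finsupp.weight_apply, Finsupp.sum, Finsupp.prod, monomial_pow, one_pow]
  exact (monomial_sum_one (R := K) _ _).symm

theorem edgeRingHom_rename_inclusion {H G : SimpleGraph V} (h : H.edgeSet ⊆ G.edgeSet)
    (f : MvPolynomial H.edgeSet K) :
    edgeRingHom K G (rename (Set.inclusion h) f) = edgeRingHom K H f := by
  rw [edgeRingHom, aeval_rename]
  rfl

theorem binomialCon_toricIdeal (G : SimpleGraph V) :
    binomialCon (toricIdeal K G) = AddCon.ker (degreeVector G) := by
  ext u v
  rw [binomialCon_iff, AddCon.ker_rel, toricIdeal, RingHom.sub_mem_ker_iff]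
  change edgeRingHom K G _ = edgeRingHom K G _ ↔ _
  rw [edgeRingHom_monomial, edgeRingHom_monomial, monomial_left_inj one_ne_zero]

theorem toricIdeal_le_iff {G : SimpleGraph V} {J : Ideal (MvPolynomial G.edgeSet K)} :
    toricIdeal K G ≤ J ↔ AddCon.ker (degreeVector G) ≤ binomialCon J := by
  refine ⟨fun h => binomialCon_toricIdeal K G ▸ binomialCon_mono h, fun h => ?_⟩
  exact ker_le_of_forall_monomial_sub_monomial_mem (edgeRingHom K G).toLinearMap (degreeVector G)
    (edgeRingHom_monomial K G) (J.restrictScalars K) fun u v huv => h huv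

/-- The ideal generated by the quadratic binomials of the toric ideal `I_G`; it is `I_G` exactly
when `G` is quadratic. -/
noncomputable def quadraticPart (G : SimpleGraph V) : Ideal (MvPolynomial G.edgeSet K) :=
  Ideal.span {f | IsQuadraticBinomial f ∧ f ∈ toricIdeal K G}

theorem quadraticPart_le_toricIdeal (G : SimpleGraph V) : quadraticPart K G ≤ toricIdeal K G :=
  Ideal.span_le.2 fun _ hf => hf.2

theorem isQuadratic_iff_ker_degreeVector_le {G : SimpleGraph V} :
    IsQuadratic K G ↔ AddCon.ker (degreeVector G) ≤ binomialCon (quadraticPart K G) := by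
  rw [← toricIdeal_le_iff]
  constructor
  · rintro ⟨S, hS, hspan⟩
    rw [hspan, Ideal.span_le]
    exact fun f hf => Ideal.subset_span ⟨hS f hf, hspan ▸ Ideal.subset_span hf⟩
  · exact fun h => ⟨_, fun f hf => hf.1, h.antisymm (quadraticPart_le_toricIdeal K G)⟩

variable {K}

theorem IsQuadraticBinomial.rename {σ τ : Type*} {f : MvPolynomial σ K}
    (hf : IsQuadraticBinomial f) {ι : σ → τ} (hι : Function.Injective ι) :
    IsQuadraticBinomial (MvPolynomial.rename ι f) := by
  obtain ⟨u, v, huv, hu, hv, rfl⟩ := hf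
  refine ⟨u.mapDomain ι, v.mapDomain ι, (Finsupp.mapDomain_injective hι).ne huv, ?_, ?_, ?_⟩
  · rwa [Finsupp.degree_mapDomain]
  · rwa [Finsupp.degree_mapDomain]
  · rw [map_sub, rename_monomial, rename_monomial]

theorem quadraticPart_le_comap_rename_inclusion {H G : SimpleGraph V}
    (h : H.edgeSet ⊆ G.edgeSet) :
    quadraticPart K H ≤ (quadraticPart K G).comap (rename (Set.inclusion h)) := by
  refine Ideal.span_le.2 fun f hf => Ideal.subset_span ⟨hf.1.rename (Set.inclusion_injective h), ?_⟩
  exact (edgeRingHom_rename_inclusion K h f).trans hf.2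

theorem IsQuadratic.binomialCon_of_support_subset {H G : SimpleGraph V} (hH : IsQuadratic K H)
    (h : H.edgeSet ⊆ G.edgeSet) {u v : G.edgeSet →₀ ℕ}
    (hu : ∀ e ∈ u.support, (e : Sym2 V) ∈ H.edgeSet)
    (hv : ∀ e ∈ v.support, (e : Sym2 V) ∈ H.edgeSet) (huv : degreeVector G u = degreeVector G v) :
    binomialCon (quadraticPart K G) u v := by
  have mem_range : ∀ w : G.edgeSet →₀ ℕ, (∀ e ∈ w.support, (e : Sym2 V) ∈ H.edgeSet) →
      w ∈ Set.range (Finsupp.mapDomain (Set.inclusion h)) := by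
    intro w hw
    rw [Finsupp.mem_range_mapDomain_iff _ (Set.inclusion_injective h)]
    intro e he
    by_contra hwe
    exact he ⟨⟨e, hw e (Finsupp.mem_support_iff.2 hwe)⟩, rfl⟩
  obtain ⟨u, rfl⟩ := mem_range u hu
  obtain ⟨v, rfl⟩ := mem_range v hv
  rw [degreeVector_mapDomain_inclusion, degreeVector_mapDomain_inclusion] at huv
  have hmem := quadraticPart_le_comap_rename_inclusion h
    ((isQuadratic_iff_ker_degreeVector_le K).1 hH huv)
  rwa [Ideal.mem_comap, map_sub, rename_monomial, rename_monomial] at hmem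

theorem binomialCon_quadraticPart_of_degree_eq_two {G : SimpleGraph V} {u v : G.edgeSet →₀ ℕ}
    (hu : u.degree = 2) (hv : v.degree = 2) (huv : degreeVector G u = degreeVector G v) :
    binomialCon (quadraticPart K G) u v := by
  by_cases hne : u = v
  · exact hne ▸ AddCon.refl _ u
  · refine Ideal.subset_span ⟨⟨u, v, hne, hu, hv, rfl⟩, ?_⟩
    rwa [← binomialCon_iff, binomialCon_toricIdeal]

theorem isQuadratic_of_exchange {M : Type*} [AddCommMonoid M] [LinearOrder M]
    [IsOrderedCancelAddMonoid M] {G P N : SimpleGraph V} (c : V → M)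
    (hP : ∀ e, e ∈ P.edgeSet ↔ e ∈ G.edgeSet ∧ 0 ≤ edgeSum c e)
    (hN : ∀ e, e ∈ N.edgeSet ↔ e ∈ G.edgeSet ∧ edgeSum c e ≤ 0)
    (hex : ∀ e ∈ G.edgeSet, ∀ f ∈ G.edgeSet, 0 < edgeSum c e → edgeSum c f < 0 →
      ∃ g ∈ G.edgeSet, ∃ h ∈ G.edgeSet, edgeSum c g ≤ 0 ∧ edgeSum c h ≤ 0 ∧
        edgeExponent e + edgeExponent f = edgeExponent g + edgeExponent h)
    (hPq : IsQuadratic K P) (hNq : IsQuadratic K N) : IsQuadratic K G := by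
  rw [isQuadratic_iff_ker_degreeVector_le]
  have hle : binomialCon (quadraticPart K G) ≤ AddCon.ker (degreeVector G) :=
    binomialCon_toricIdeal K G ▸ binomialCon_mono (quadraticPart_le_toricIdeal K G)
  refine addConKer_le_of_exchange hle (fun e : G.edgeSet => edgeSum c (e : Sym2 V)) ?_ ?_ ?_ ?_
  · intro u v huv
    rw [← weight_degreeVector, ← weight_degreeVector, huv]
  · intro e f he hf
    obtain ⟨g, hg, h, hh, hcg, hch, hexp⟩ := hex e e.2 f f.2 he hf
    refine ⟨⟨g, hg⟩, ⟨h, hh⟩, hcg, hch, binomialCon_quadraticPart_of_degree_eq_two ?_ ?_ ?_⟩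
    · simp
    · simp
    · simpa only [degreeVector_single_add_single] using hexp
  · exact fun u v huv hu hv => hPq.binomialCon_of_support_subset (fun e he => ((hP e).1 he).1)
      (fun e he => (hP e).2 ⟨e.2, hu e he⟩) (fun e he => (hP e).2 ⟨e.2, hv e he⟩) huv
  · exact fun u v huv hu hv => hNq.binomialCon_of_support_subset (fun e he => ((hN e).1 he).1)
      (fun e he => (hN e).2 ⟨e.2, hu e he⟩) (fun e he => (hN e).2 ⟨e.2, hv e he⟩) huv

end ToricIdeal

end EdgePolytope

open EdgePolytope in
theorem mainTheorem3_general (K : Type*) [Field K] {V : Type*} [Fintype V] [DecidableEq V]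
    (G : SimpleGraph V) (a : V → ℝ) (b : ℝ)
    (hint : IsIntegralPolytope (edgePolytope G ∩ posHalfSpace a b))
    (hpos : IsQuadratic K (posSubgraph G a b)) (hneg : IsQuadratic K (negSubgraph G a b)) :
    IsQuadratic K G := by
  -- All edge vectors lie in `∑ xᵢ = 2`, so subtracting `b / 2` from each `aᵢ` makes `ℋ` linear.
  have hshift : ∀ e, edgeSum (fun v => a v - b / 2) e = edgeSum a e - b := by
    intro e
    induction e with | h i j => simp only [edgeSum_mk]; ring
  refine isQuadratic_of_exchange (fun v => a v - b / 2) (fun e => ?_) (fun e => ?_) ?_ hpos hneg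
  · rw [mem_edgeSet_posSubgraph, hshift, sub_nonneg]
  · rw [mem_edgeSet_negSubgraph, hshift, sub_nonpos]
  · simpa only [hshift, sub_pos, sub_neg, sub_nonpos] using
      fun e he f hf => exists_exchange_of_separated hint he hf

theorem mainTheorem3 (K : Type*) [Field K] {V : Type*} [Fintype V] [DecidableEq V]
    (G : SimpleGraph V) (hG : G.Connected) (a : V → ℝ) (b : ℝ)
    (hH : EdgePolytope.IsSeparatingHyperplane (EdgePolytope.edgePolytope G) a b)
    (hpos : EdgePolytope.IsQuadratic K (EdgePolytope.posSubgraph G a b))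
    (hneg : EdgePolytope.IsQuadratic K (EdgePolytope.negSubgraph G a b)) :
    EdgePolytope.IsQuadratic K G :=
  mainTheorem3_general K G a b hH.integral_pos hpos hneg
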